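/- Let $(X_i)_{i\ge 1}$ be a strictly stationary sequence of real random variables with continuous marginal distribution function $F$, and let $M_n=\max(X_1,\dots,X_n)$. Suppose $F\in\mathrm{MDA}(H)$ with normalizing sequences $c_n>0$ and $d_n$, i.e. $H$ is a nondegenerate distribution function and $F^n(c_nx+d_n)\to H(x)$ at every continuity point $x$ of $H$. Notation. Let $C_n$ be the copula of $(X_1,\dots,X_n)$, i.e. the joint distribution function of $(F(X_1),\dots,F(X_n))$, let $\delta_n(u)=C_n(u,\dots,u)$ be its diagonal and, for a rate $r=(r_n)$ with $r_n>0$, let $D_n^r(u)=\delta_n(u^{1/r_n})$, $u\in[0,1]$. The sequence has an asymptotic power diagonal with index $\theta>0$ and rate $r$ if $r_n\to\infty$ and $D_n^r(u)\to u^\theta$ for all $u\in[0,1]$; it has an asymptotic power diagonal with index $\theta$ if this holds for some rate $r$. The condition $\mathcal D(u_n)$ means: there are numbers $\alpha(n,s)$ with $$\Bigl|\mathbb P\bigl(\max_{i\in A\cup B}X_i\le u_n\bigr)-\mathbb P\bigl(\max_{i\in A}X_i\le u_n\bigr)\,\mathbb P\bigl(\max_{i\in B}X_i\le u_n\bigr)\Bigr|\le\alpha(n,s)$$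 for all $n,s\ge1$ and all nonempty $A,B\subseteq\{1,\dots,n\}$ with $\min B-\max A\ge s$, and $\alpha(n,s_n)\to0$ for some sequence of positive integers $s_n=o(n)$. The condition $\mathcal D'(u_n)$ means $$\lim_{k\to\infty}\limsup_{n\to\infty}\, n\sum_{j=2}^{\lfloor n/k\rfloor}\mathbb P(X_1>u_n,\,X_j>u_n)=0.$$ (i) Suppose that $\mathcal D(u_n)$ holds with $u_n=c_nx+d_n$ for each $x$ with $H(x)>0$ and that, with $r_n=n$, there are $u,\gamma\in(0,1)$ such that $D_n^r(u)\to\gamma$. Then there is $\theta\in(0,1]$ such that the sequence has an asymptotic power diagonal with index $\theta$, the rate being $r_n=n$, and $\theta$ is the extremal index of $(X_i)$, meaning that $(M_n-d_n)/c_n$ converges in distribution to $H^\theta$. (ii) Suppose that $\mathcal D(u_n)$ and $\mathcal D'(u_n)$ hold with $u_n=c_nx+d_n$ for each $x$ with $H(x)>0$ (in particular, if they hold for each $x\in\mathbb R$). Then the sequence has an asymptotic power diagonal with index $1$, and the rate may be chosen as $r_n=n$. -/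

import Mathlib

open MeasureTheory ProbabilityTheory Filter Topology Set Asymptotics
open scoped ENNReal

namespace CopulaDiagonal

/-! A sequence `X₁, X₂, …` is coded as `X : ℕ → Ω → ℝ` with `X i` standing for `X_{i+1}`; the first
`n` variables are `X i` with `i < n`, i.e. `i ∈ Finset.range n`. -/

section Basic

variable {Ω : Type*} [MeasurableSpace Ω]

/-- Strict stationarity: the law of the whole sequence is invariant under every shift of time. -/
def StrictlyStationary (μ : Measure Ω) (X : ℕ → Ω → ℝ) : Prop :=
  ∀ h : ℕ, IdentDistrib (fun ω (i : ℕ) => X (i + h) ω) (fun ω (i : ℕ) => X i ω) μ μ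

/-- The (common) marginal distribution function `F` of the sequence. -/
noncomputable def margin (μ : Measure Ω) (X : ℕ → Ω → ℝ) (x : ℝ) : ℝ :=
  cdf (μ.map (X 0)) x

/-- The maximum of the variables `X i`, `i ∈ A` (used for nonempty `A` only). -/
noncomputable def blockMax (X : ℕ → Ω → ℝ) (A : Finset ℕ) (ω : Ω) : ℝ :=
  ⨆ i : A, X i ω

/-- `M_n`, the maximum of the first `n` variables (`n ≥ 1`). -/
noncomputable def runMax (X : ℕ → Ω → ℝ) (n : ℕ) (ω : Ω) : ℝ :=
  blockMax X (Finset.range n) ω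

/-- The copula `C_n` of the first `n` variables of a sequence with continuous margin `F`: the joint
distribution function of `F(X₁), …, F(X_n)`. See `copula_margin` and `sklar` below. -/
noncomputable def copula (μ : Measure Ω) (X : ℕ → Ω → ℝ) (n : ℕ) (u : Fin n → ℝ) : ℝ :=
  μ.real {ω | ∀ i : Fin n, margin μ X (X i ω) ≤ u i}

/-- The diagonal `δ_n(u) = C_n(u, …, u)`. -/
noncomputable def copulaDiag (μ : Measure Ω) (X : ℕ → Ω → ℝ) (n : ℕ) (u : ℝ) : ℝ :=
  copula μ X n (fun _ => u)

/-- The diagonal power distortion `D_n^r(u) = δ_n(u^{1/r_n})`. -/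
noncomputable def diagPowerDistortion (μ : Measure Ω) (X : ℕ → Ω → ℝ) (r : ℕ → ℝ) (n : ℕ)
    (u : ℝ) : ℝ :=
  copulaDiag μ X n (u ^ (1 / r n))

/-- Asymptotic power diagonal with index `θ > 0`, the rate being `r`. -/
def HasAsymptoticPowerDiagonalWithRate (μ : Measure Ω) (X : ℕ → Ω → ℝ) (r : ℕ → ℝ) (θ : ℝ) :
    Prop :=
  0 < θ ∧ (∀ n, 1 ≤ n → 0 < r n) ∧ Tendsto r atTop atTop ∧
    ∀ u ∈ Icc (0 : ℝ) 1, Tendsto (fun n => diagPowerDistortion μ X r n u) atTop (𝓝 (u ^ θ))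

/-- Asymptotic power diagonal with index `θ > 0`. -/
def HasAsymptoticPowerDiagonal (μ : Measure Ω) (X : ℕ → Ω → ℝ) (θ : ℝ) : Prop :=
  ∃ r : ℕ → ℝ, HasAsymptoticPowerDiagonalWithRate μ X r θ

/-- Distribution functions of probability measures on `ℝ`. -/
def IsDistributionFunction (H : ℝ → ℝ) : Prop :=
  Monotone H ∧ (∀ x, ContinuousWithinAt H (Ici x) x) ∧
    Tendsto H atBot (𝓝 0) ∧ Tendsto H atTop (𝓝 1)

/-- A distribution function is nondegenerate if it is not that of a point mass, i.e. if it has a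
value other than `0` and `1`. -/
def Nondegenerate (H : ℝ → ℝ) : Prop :=
  ∃ x, H x ∈ Ioo (0 : ℝ) 1

/-- `F ∈ MDA(H)` with normalizing sequences `c_n > 0` and `d_n`: `H` is a nondegenerate distribution
function and the maximum `M_n^*` of `n` independent variables with distribution function `F`, whose
distribution function is `F^n`, satisfies `(M_n^* - d_n) / c_n → H` in distribution. -/
def InMDA (F H : ℝ → ℝ) (c d : ℕ → ℝ) : Prop :=
  IsDistributionFunction H ∧ Nondegenerate H ∧ (∀ n, 1 ≤ n → 0 < c n) ∧
    ∀ x, ContinuousAt H x → Tendsto (fun n => F (c n * x + d n) ^ n) atTop (𝓝 (H x))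

/-- Convergence in distribution of random variables `Z_n` to the distribution function `G`. -/
def TendstoInLaw (μ : Measure Ω) (Z : ℕ → Ω → ℝ) (G : ℝ → ℝ) : Prop :=
  ∀ x, ContinuousAt G x → Tendsto (fun n => μ.real {ω | Z n ω ≤ x}) atTop (𝓝 (G x))

/-- The distributional mixing condition `D(u_n)`. -/
def CondD (μ : Measure Ω) (X : ℕ → Ω → ℝ) (u : ℕ → ℝ) : Prop :=
  ∃ α : ℕ → ℕ → ℝ,
    (∀ n s : ℕ, 1 ≤ s → ∀ A B : Finset ℕ, A.Nonempty → B.Nonempty →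
      A ⊆ Finset.range n → B ⊆ Finset.range n → (∀ i ∈ A, ∀ j ∈ B, i + s ≤ j) →
      |μ.real {ω | blockMax X (A ∪ B) ω ≤ u n}
        - μ.real {ω | blockMax X A ω ≤ u n} * μ.real {ω | blockMax X B ω ≤ u n}| ≤ α n s) ∧
    ∃ s : ℕ → ℕ, (∀ n, 1 ≤ s n) ∧ (fun n => (s n : ℝ)) =o[atTop] (fun n => (n : ℝ)) ∧
      Tendsto (fun n => α n (s n)) atTop (𝓝 0)

/-- The anticlustering condition `D'(u_n)`, that is,
`lim_{k → ∞} limsup_{n → ∞} n ∑_{j=2}^{⌊n/k⌋} P(X₁ > u_n, X_j > u_n) = 0`, with values in `[0,∞]`. -/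
def CondD' (μ : Measure Ω) (X : ℕ → Ω → ℝ) (u : ℕ → ℝ) : Prop :=
  Tendsto (fun k : ℕ => limsup (fun n : ℕ =>
      (n : ℝ≥0∞) * ∑ j ∈ Finset.Ico 1 (n / k), μ {ω | u n < X 0 ω ∧ u n < X j ω}) atTop)
    atTop (𝓝 0)

end Basic

section Facts

variable {Ω : Type*} [MeasurableSpace Ω] {μ : Measure Ω} [IsProbabilityMeasure μ] {X : ℕ → Ω → ℝ}

theorem blockMax_le_iff {A : Finset ℕ} (hA : A.Nonempty) (ω : Ω) (x : ℝ) :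
    blockMax X A ω ≤ x ↔ ∀ i ∈ A, X i ω ≤ x := by
  have : Nonempty A := hA.to_subtype
  unfold blockMax
  rw [ciSup_le_iff (Set.finite_range _).bddAbove]
  exact ⟨fun h i hi => h ⟨i, hi⟩, fun h i => h i i.2⟩

theorem margin_eq (hX : ∀ i, Measurable (X i)) (hs : StrictlyStationary μ X) (i : ℕ) (x : ℝ) :
    μ.real {ω | X i ω ≤ x} = margin μ X x := by
  have h1 : IdentDistrib (X i) (X 0) μ μ := by
    have := (hs i).comp (measurable_pi_apply (0 : ℕ))
    simpa [Function.comp_def] using this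
  have : IsProbabilityMeasure (μ.map (X 0)) := Measure.isProbabilityMeasure_map (hX 0).aemeasurable
  have h2 : μ {ω | X i ω ≤ x} = μ {ω | X 0 ω ≤ x} := h1.measure_mem_eq (measurableSet_Iic (a := x))
  rw [margin, cdf_eq_real, map_measureReal_apply (hX 0) measurableSet_Iic, measureReal_def, h2]
  rfl

theorem margin_mono : Monotone (margin μ X) := (cdf (μ.map (X 0))).mono

/-- `{F(X_i) ≤ F(x)}` and `{X_i ≤ x}` are almost surely equal. -/
theorem margin_le_ae (hX : ∀ i, Measurable (X i)) (hs : StrictlyStationary μ X)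
    (hF : Continuous (margin μ X)) (i : ℕ) (x : ℝ) :
    ∀ᵐ ω ∂μ, margin μ X (X i ω) ≤ margin μ X x ↔ X i ω ≤ x := by
  have key : μ {ω | x < X i ω ∧ margin μ X (X i ω) ≤ margin μ X x} = 0 := by
    have hq : ∀ q : ℝ, margin μ X q ≤ margin μ X x → μ {ω | x < X i ω ∧ X i ω ≤ q} = 0 := by
      intro q hq
      rcases le_or_gt q x with h | h
      · convert measure_empty (μ := μ)
        ext ω
        simp only [mem_ofPred_eq, mem_empty_iff_false, iff_false, not_and, not_le]
        intro h'
        exact lt_of_le_of_lt h h'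
      · have e : {ω | x < X i ω ∧ X i ω ≤ q} = {ω | X i ω ≤ q} \ {ω | X i ω ≤ x} := by
          ext ω
          simp [and_comm]
        have hsub : {ω | X i ω ≤ x} ⊆ {ω | X i ω ≤ q} := fun ω hω => le_trans hω h.le
        have hm : MeasurableSet {ω | X i ω ≤ x} := hX i measurableSet_Iic
        rw [← measureReal_eq_zero_iff, e, measureReal_sdiff hsub hm, margin_eq hX hs,
          margin_eq hX hs]
        linarith [margin_mono (μ := μ) (X := X) h.le]
    set S : Set ℝ := {y | margin μ X y ≤ margin μ X x} with hS
    by_cases hb : BddAbove S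
    · have hcl : IsClosed S := isClosed_le hF continuous_const
      have hmem : sSup S ∈ S := hcl.csSup_mem ⟨x, le_refl (margin μ X x)⟩ hb
      refine measure_mono_null ?_ (hq (sSup S) hmem)
      rintro ω ⟨h1, h2⟩
      exact ⟨h1, le_csSup hb h2⟩
    · have hall : ∀ y, y ∈ S := by
        intro y
        obtain ⟨z, hz, hyz⟩ := not_bddAbove_iff.1 hb y
        exact (margin_mono hyz.le).trans hz
      refine measure_mono_null (t := ⋃ n : ℕ, {ω | x < X i ω ∧ X i ω ≤ n}) ?_
        (measure_iUnion_null fun n => hq n (hall n))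
      rintro ω ⟨h1, -⟩
      obtain ⟨n, hn⟩ := exists_nat_ge (X i ω)
      exact mem_iUnion.2 ⟨n, h1, hn⟩
  have : ∀ᵐ ω ∂μ, ¬ (x < X i ω ∧ margin μ X (X i ω) ≤ margin μ X x) := by
    rw [ae_iff]
    simpa using key
  filter_upwards [this] with ω hω
  constructor
  · intro h
    by_contra h'
    exact hω ⟨not_le.1 h', h⟩
  · exact fun h => margin_mono h

/-- Sklar's identity `P(X₁ ≤ x₁, …, X_n ≤ x_n) = C_n(F(x₁), …, F(x_n))`. -/
theorem sklar (hX : ∀ i, Measurable (X i)) (hs : StrictlyStationary μ X)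
    (hF : Continuous (margin μ X)) (n : ℕ) (x : Fin n → ℝ) :
    μ.real {ω | ∀ i : Fin n, X i ω ≤ x i} = copula μ X n (fun i => margin μ X (x i)) := by
  unfold copula
  apply measureReal_congr
  have h : ∀ᵐ ω ∂μ, ∀ i : Fin n, margin μ X (X i ω) ≤ margin μ X (x i) ↔ X i ω ≤ x i :=
    ae_all_iff.2 fun i => margin_le_ae hX hs hF i (x i)
  filter_upwards [h] with ω hω
  exact propext (forall_congr' fun i => (hω i).symm)

/-- The margins of `C_n` are standard uniform. -/
theorem copula_margin (hX : ∀ i, Measurable (X i)) (hs : StrictlyStationary μ X)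
    (hF : Continuous (margin μ X)) (i : ℕ) {u : ℝ} (hu : u ∈ Icc (0 : ℝ) 1) :
    μ.real {ω | margin μ X (X i ω) ≤ u} = u := by
  have hval : ∀ x, μ.real {ω | margin μ X (X i ω) ≤ margin μ X x} = margin μ X x := by
    intro x
    rw [← margin_eq hX hs i x]
    apply measureReal_congr
    filter_upwards [margin_le_ae hX hs hF i x] with ω hω
    rw [← margin_eq hX hs i x] at hω
    exact propext hω
  have hbot : Tendsto (margin μ X) atBot (𝓝 0) := tendsto_cdf_atBot _
  have htop : Tendsto (margin μ X) atTop (𝓝 1) := tendsto_cdf_atTop _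
  have hIoo : ∀ v ∈ Ioo (0 : ℝ) 1, μ.real {ω | margin μ X (X i ω) ≤ v} = v := by
    intro v hv
    obtain ⟨a, ha⟩ := (hbot.eventually_lt_const hv.1).exists
    obtain ⟨b, hb⟩ := (htop.eventually_const_lt hv.2).exists
    obtain ⟨x, rfl⟩ := mem_range_of_exists_le_of_exists_ge hF ⟨a, ha.le⟩ ⟨b, hb.le⟩
    exact hval x
  rcases eq_or_lt_of_le hu.1 with h0 | h0
  · subst h0
    refine le_antisymm (le_of_forall_pos_le_add fun ε hε => ?_) measureReal_nonneg
    have hv : min ε (1 / 2) ∈ Ioo (0 : ℝ) 1 :=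
      ⟨lt_min hε (by norm_num), (min_le_right _ _).trans_lt (by norm_num)⟩
    calc μ.real {ω | margin μ X (X i ω) ≤ 0}
        ≤ μ.real {ω | margin μ X (X i ω) ≤ min ε (1 / 2)} :=
          measureReal_mono fun ω hω => le_trans hω hv.1.le
      _ = min ε (1 / 2) := hIoo _ hv
      _ ≤ 0 + ε := by simp
  · rcases eq_or_lt_of_le hu.2 with h1 | h1
    · subst h1
      have : {ω | margin μ X (X i ω) ≤ 1} = univ := eq_univ_of_forall fun ω => cdf_le_one _ _
      rw [this, probReal_univ]
    · exact hIoo u ⟨h0, h1⟩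

/-- `P(M_n ≤ x) = δ_n(F(x))`. -/
theorem runMax_eq_copulaDiag (hX : ∀ i, Measurable (X i)) (hs : StrictlyStationary μ X)
    (hF : Continuous (margin μ X)) {n : ℕ} (hn : 1 ≤ n) (x : ℝ) :
    μ.real {ω | runMax X n ω ≤ x} = copulaDiag μ X n (margin μ X x) := by
  rw [copulaDiag, ← sklar hX hs hF n (fun _ => x)]
  congr 1
  ext ω
  have hne : (Finset.range n).Nonempty := Finset.nonempty_range_iff.2 (by omega)
  simp only [runMax, mem_ofPred_eq, blockMax_le_iff hne, Finset.mem_range]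
  exact ⟨fun h i => h i i.2, fun h i hi => h ⟨i, hi⟩⟩

end Facts

end CopulaDiagonal

open CopulaDiagonal

set_option linter.unusedSectionVars false

/-! With rate `n`, put `D_n(v) = δ_n(v^{1/n})`. The heart of the matter is the block relation
`D_n(v) - D_{⌊n/k⌋}(v^{1/k})^k → 0` for all `v ∈ (0,1)` and `k ≥ 1`. Mixing, with negligible gaps
cut out, splits `n` variables into `k` nearly independent blocks (`abs_levelProb_mul_sub_pow_le`,
`CondD.tendsto_levelProb_sub_pow`). Since `δ_n` is `n`-Lipschitz, only the limit of `n(1 - level)`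
matters, so `F(x_n)` may be traded for `v^{1/n}` (`tendsto_copulaDiag_sub`).

Mixing is given only at levels with `F^n → H(x) > 0`. Such a sequence serves every `v ≥ H(x)` after
a change of time scale, and `InMDA.exists_pos_lt` supplies arbitrarily small positive `H(x)`. This
is where continuity of `F` excludes a jump of `H` at its left endpoint.

If `D_n(u) → γ`, the block relation forces `D_n(u^t) → γ^t` for rational `t > 0`, and monotonicity
gives real `t`. Every `v ∈ (0,1)` is some `u^t`, so the limit is `v^θ` with `θ = log γ / log u`. The
union bound yields `θ ≤ 1`, and the identity `P(M_n ≤ c_n x + d_n) = D_n(F(c_n x + d_n)^n)` yields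
the extremal index. For (ii), anticlustering and Bonferroni identify the limit at a single `u =
H(x)` as `γ = u`, hence `θ = 1`. -/

namespace CopulaDiagonal

/-! ### Union bounds, Lipschitz diagonals and the block inequality -/

section LevelProb

variable {Ω : Type*} [MeasurableSpace Ω] {μ : Measure Ω} [IsProbabilityMeasure μ] {X : ℕ → Ω → ℝ}

/-- The probability that no variable with index in `A` exceeds the level `x`. -/
noncomputable def levelProb (μ : Measure Ω) (X : ℕ → Ω → ℝ) (A : Finset ℕ) (x : ℝ) : ℝ :=
  μ.real {ω | ∀ i ∈ A, X i ω ≤ x}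

theorem levelProb_eq_blockMax {A : Finset ℕ} (hA : A.Nonempty) (x : ℝ) :
    levelProb μ X A x = μ.real {ω | blockMax X A ω ≤ x} := by
  simp only [levelProb, blockMax_le_iff hA]

theorem copulaDiag_margin (hX : ∀ i, Measurable (X i)) (hs : StrictlyStationary μ X)
    (hF : Continuous (margin μ X)) (n : ℕ) (x : ℝ) :
    copulaDiag μ X n (margin μ X x) = levelProb μ X (Finset.range n) x := by
  rw [copulaDiag, ← sklar hX hs hF n (fun _ => x), levelProb]
  congr 1
  ext ω
  simp only [mem_ofPred_eq, Finset.mem_range]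
  exact ⟨fun h i hi => h ⟨i, hi⟩, fun h i => h i i.2⟩

theorem levelProb_anti {A B : Finset ℕ} (hAB : A ⊆ B) (x : ℝ) :
    levelProb μ X B x ≤ levelProb μ X A x :=
  measureReal_mono fun _ hω i hi => hω i (hAB hi)

theorem levelProb_nonneg (A : Finset ℕ) (x : ℝ) : 0 ≤ levelProb μ X A x := measureReal_nonneg

theorem levelProb_le_one (A : Finset ℕ) (x : ℝ) : levelProb μ X A x ≤ 1 := measureReal_le_one

theorem measureReal_gt (hX : ∀ i, Measurable (X i)) (hs : StrictlyStationary μ X) (i : ℕ) (x : ℝ) :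
    μ.real {ω | x < X i ω} = 1 - margin μ X x := by
  have h := probReal_compl_eq_one_sub (μ := μ) (hX i (measurableSet_Iic (a := x)))
  rw [← margin_eq hX hs i x]
  convert h using 2
  · ext ω
    simp
  · rfl

/-- Enlarging the index set costs at most one tail probability per new index. This pays for
refilling the gaps between blocks and for the remainder of a division. -/
theorem levelProb_le_add (hX : ∀ i, Measurable (X i)) (hs : StrictlyStationary μ X)
    {A B C : Finset ℕ} (hBAC : B ⊆ A ∪ C) (x : ℝ) :
    levelProb μ X A x ≤ levelProb μ X B x + C.card * (1 - margin μ X x) := by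
  have hsub : {ω | ∀ i ∈ A, X i ω ≤ x} ⊆
      {ω | ∀ i ∈ B, X i ω ≤ x} ∪ ⋃ i ∈ C, {ω | x < X i ω} := by
    intro ω hω
    by_cases h : ∃ i ∈ C, x < X i ω
    · obtain ⟨i, hi, hx⟩ := h
      exact Or.inr (mem_iUnion₂.2 ⟨i, hi, hx⟩)
    · push Not at h
      refine Or.inl fun i hi => ?_
      rcases Finset.mem_union.1 (hBAC hi) with h' | h'
      exacts [hω i h', h i h']
  calc levelProb μ X A x ≤ _ := measureReal_mono hsub
    _ ≤ _ := measureReal_union_le _ _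
    _ ≤ levelProb μ X B x + ∑ i ∈ C, μ.real {ω | x < X i ω} := by
      gcongr
      · exact le_rfl
      · exact measureReal_biUnion_finset_le _ _
    _ = _ := by simp only [measureReal_gt hX hs, Finset.sum_const, nsmul_eq_mul]

theorem levelProb_map_add (hs : StrictlyStationary μ X) (A : Finset ℕ) (h : ℕ) (x : ℝ) :
    levelProb μ X (A.map (addRightEmbedding h)) x = levelProb μ X A x := by
  have hm : MeasurableSet {f : ℕ → ℝ | ∀ i ∈ A, f i ≤ x} := by
    have : {f : ℕ → ℝ | ∀ i ∈ A, f i ≤ x} = ⋂ i ∈ A, {f : ℕ → ℝ | f i ≤ x} := by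
      ext f; simp
    rw [this]
    exact Finset.measurableSet_biInter _ fun i _ => measurable_pi_apply i measurableSet_Iic
  have := (hs h).measure_mem_eq hm
  simp only [levelProb, measureReal_def]
  congr 1
  convert this using 2
  · ext ω
    simp
  · rfl

theorem copulaDiag_eq (n : ℕ) (v : ℝ) :
    copulaDiag μ X n v = μ.real {ω | ∀ i ∈ Finset.range n, margin μ X (X i ω) ≤ v} := by
  unfold copulaDiag copula
  congr 1
  ext ω
  simp only [mem_ofPred_eq, Finset.mem_range]
  exact ⟨fun h i hi => h ⟨i, hi⟩, fun h i => h i i.2⟩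

theorem copulaDiag_nonneg (n : ℕ) (v : ℝ) : 0 ≤ copulaDiag μ X n v := measureReal_nonneg

theorem copulaDiag_le_one (n : ℕ) (v : ℝ) : copulaDiag μ X n v ≤ 1 := measureReal_le_one

theorem copulaDiag_mono (n : ℕ) : Monotone (copulaDiag μ X n) := fun _ _ h =>
  measureReal_mono fun _ hω i => (hω i).trans h

/-- The two events differ only if some `F(X_i)` falls in `(v, w]`, and each `F(X_i)` is uniform. -/
theorem copulaDiag_le_add (hX : ∀ i, Measurable (X i)) (hs : StrictlyStationary μ X)
    (hF : Continuous (margin μ X)) (n : ℕ) {v w : ℝ} (hv : v ∈ Icc (0 : ℝ) 1)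
    (hw : w ∈ Icc (0 : ℝ) 1) (hvw : v ≤ w) :
    copulaDiag μ X n w ≤ copulaDiag μ X n v + n * (w - v) := by
  have hsub : {ω | ∀ i ∈ Finset.range n, margin μ X (X i ω) ≤ w} ⊆
      {ω | ∀ i ∈ Finset.range n, margin μ X (X i ω) ≤ v} ∪
        ⋃ i ∈ Finset.range n,
          ({ω | margin μ X (X i ω) ≤ w} \ {ω | margin μ X (X i ω) ≤ v}) := by
    intro ω hω
    by_cases h : ∀ i ∈ Finset.range n, margin μ X (X i ω) ≤ v
    · exact Or.inl h
    · push Not at h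
      obtain ⟨i, hi, hx⟩ := h
      exact Or.inr (mem_iUnion₂.2 ⟨i, hi, hω i hi, not_le.2 hx⟩)
  have hval : ∀ i, μ.real ({ω | margin μ X (X i ω) ≤ w} \ {ω | margin μ X (X i ω) ≤ v}) =
      w - v := by
    intro i
    have hm : MeasurableSet {ω | margin μ X (X i ω) ≤ v} :=
      (hF.measurable.comp (hX i)) measurableSet_Iic
    rw [measureReal_sdiff (show {ω | margin μ X (X i ω) ≤ v} ⊆ {ω | margin μ X (X i ω) ≤ w} from
      fun ω hω => le_trans (show margin μ X (X i ω) ≤ v from hω) hvw) hm, copula_margin hX hs hF i hv,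
      copula_margin hX hs hF i hw]
  rw [copulaDiag_eq, copulaDiag_eq]
  calc _ ≤ _ := measureReal_mono hsub
    _ ≤ _ := measureReal_union_le _ _
    _ ≤ _ + ∑ i ∈ Finset.range n,
        μ.real ({ω | margin μ X (X i ω) ≤ w} \ {ω | margin μ X (X i ω) ≤ v}) := by
      gcongr
      exact measureReal_biUnion_finset_le _ _
    _ = _ := by simp only [hval, Finset.sum_const, nsmul_eq_mul, Finset.card_range]

theorem abs_copulaDiag_sub_le (hX : ∀ i, Measurable (X i)) (hs : StrictlyStationary μ X)
    (hF : Continuous (margin μ X)) (n : ℕ) {v w : ℝ} (hv : v ∈ Icc (0 : ℝ) 1)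
    (hw : w ∈ Icc (0 : ℝ) 1) :
    |copulaDiag μ X n v - copulaDiag μ X n w| ≤ n * |v - w| := by
  rcases le_total v w with h | h
  · rw [abs_sub_comm, abs_sub_comm v, abs_of_nonneg (sub_nonneg.2 h),
      abs_of_nonneg (sub_nonneg.2 (copulaDiag_mono n h))]
    linarith [copulaDiag_le_add hX hs hF n hv hw h]
  · rw [abs_of_nonneg (sub_nonneg.2 h), abs_of_nonneg (sub_nonneg.2 (copulaDiag_mono n h))]
    linarith [copulaDiag_le_add hX hs hF n hw hv h]

theorem copulaDiag_one (n : ℕ) : copulaDiag μ X n 1 = 1 := by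
  have : {ω | ∀ i ∈ Finset.range n, margin μ X (X i ω) ≤ 1} = univ :=
    eq_univ_of_forall fun ω i _ => cdf_le_one _ _
  rw [copulaDiag_eq, this, probReal_univ]

theorem copulaDiag_zero (hX : ∀ i, Measurable (X i)) (hs : StrictlyStationary μ X)
    (hF : Continuous (margin μ X)) {n : ℕ} (hn : 1 ≤ n) : copulaDiag μ X n 0 = 0 := by
  refine le_antisymm ?_ (copulaDiag_nonneg n 0)
  rw [copulaDiag_eq]
  refine le_trans (measureReal_mono fun ω hω => ?_)
    (copula_margin hX hs hF 0 (left_mem_Icc.2 zero_le_one)).le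
  exact hω 0 (Finset.mem_range.2 hn)

theorem margin_mem_Icc (x : ℝ) : margin μ X x ∈ Icc (0 : ℝ) 1 := ⟨cdf_nonneg _ _, cdf_le_one _ _⟩

/-- Under the mixing inequality with gap `s`, the maximum over `k` blocks of length `m` behaves like
`k` independent block maxima. -/
theorem abs_levelProb_mul_sub_pow_le (hX : ∀ i, Measurable (X i)) (hs : StrictlyStationary μ X)
    {x a : ℝ} {N s m : ℕ} (hs1 : 1 ≤ s) (hsm : s < m)
    (hmix : ∀ A B : Finset ℕ, A.Nonempty → B.Nonempty →
      A ⊆ Finset.range N → B ⊆ Finset.range N → (∀ i ∈ A, ∀ j ∈ B, i + s ≤ j) →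
      |μ.real {ω | blockMax X (A ∪ B) ω ≤ x}
        - μ.real {ω | blockMax X A ω ≤ x} * μ.real {ω | blockMax X B ω ≤ x}| ≤ a)
    (k : ℕ) (hk : (k + 1) * m ≤ N) :
    |levelProb μ X (Finset.range ((k + 1) * m)) x - levelProb μ X (Finset.range m) x ^ (k + 1)| ≤
      k * (a + 2 * (s * (1 - margin μ X x))) := by
  induction k with
  | zero => simp
  | succ k ih =>
    have hle : (k + 1) * m ≤ N := le_trans (by nlinarith) hk
    have ih := ih hle
    have hF0 : 0 ≤ 1 - margin μ X x := sub_nonneg.2 (margin_mem_Icc x).2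
    have hsplit : (k + 1 + 1) * m = (k + 1) * m + m := by ring
    have hpos : m ≤ (k + 1) * m := by nlinarith
    set A := Finset.range ((k + 1) * m) with hA
    -- The last block loses its first `s` indices, which creates the gap needed for mixing. Adding a
    -- block thus costs `a` for mixing, plus `s(1 - F(x))` for refilling the gap and the same again
    -- for replacing the shortened block by a full one.
    set B := (Finset.range (m - s)).map (addRightEmbedding ((k + 1) * m + s)) with hB
    have hmemB : ∀ j, j ∈ B → (k + 1) * m + s ≤ j ∧ j < (k + 1) * m + m := by
      intro j hj
      simp only [hB, Finset.mem_map, Finset.mem_range, addRightEmbedding_apply] at hj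
      omega
    have hAne : A.Nonempty := Finset.nonempty_range_iff.2 (by omega)
    have hBne : B.Nonempty := by
      simp only [hB, Finset.map_nonempty]
      exact Finset.nonempty_range_iff.2 (by omega)
    have h1 := hmix A B hAne hBne (Finset.range_subset_range.2 hle)
      (fun j hj => Finset.mem_range.2 (by have := hmemB j hj; omega))
      (fun i hi j hj => by have := hmemB j hj; have := Finset.mem_range.1 hi; omega)
    rw [← levelProb_eq_blockMax hAne, ← levelProb_eq_blockMax hBne,
      ← levelProb_eq_blockMax (hAne.mono Finset.subset_union_left), hB, levelProb_map_add hs,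
      ← hB] at h1
    have h2 : levelProb μ X (A ∪ B) x ≤ levelProb μ X (Finset.range ((k + 1 + 1) * m)) x +
        s * (1 - margin μ X x) := by
      have := levelProb_le_add hX hs (A := A ∪ B) (B := Finset.range ((k + 1 + 1) * m))
        (C := (Finset.range s).map (addRightEmbedding ((k + 1) * m))) (fun j hj => by
          have hj := Finset.mem_range.1 hj
          simp only [hA, hB, Finset.mem_union, Finset.mem_map, Finset.mem_range,
            addRightEmbedding_apply]
          by_cases h1 : j < (k + 1) * m
          · exact Or.inl (Or.inl h1)
          · by_cases h2 : j < (k + 1) * m + s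
            · exact Or.inr ⟨j - (k + 1) * m, by omega, by omega⟩
            · exact Or.inl (Or.inr ⟨j - ((k + 1) * m + s), by omega, by omega⟩)) x
      simpa using this
    have h3 : levelProb μ X (Finset.range ((k + 1 + 1) * m)) x ≤ levelProb μ X (A ∪ B) x := by
      refine levelProb_anti (fun j hj => Finset.mem_range.2 ?_) x
      rcases Finset.mem_union.1 hj with h | h
      · have := Finset.mem_range.1 h; omega
      · have := hmemB j h; omega
    have h4 : levelProb μ X (Finset.range m) x ≤ levelProb μ X (Finset.range (m - s)) x :=
      levelProb_anti (Finset.range_subset_range.2 (by omega)) x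
    have h5 : levelProb μ X (Finset.range (m - s)) x ≤ levelProb μ X (Finset.range m) x +
        s * (1 - margin μ X x) := by
      have := levelProb_le_add hX hs (A := Finset.range (m - s)) (B := Finset.range m)
        (C := (Finset.range s).map (addRightEmbedding (m - s))) (fun j hj => by
          have hj := Finset.mem_range.1 hj
          simp only [Finset.mem_union, Finset.mem_map, Finset.mem_range,
            addRightEmbedding_apply]
          by_cases h1 : j < m - s
          · exact Or.inl h1
          · exact Or.inr ⟨j - (m - s), by omega, by omega⟩) x
      simpa using this
    set P := levelProb μ X (Finset.range ((k + 1 + 1) * m)) x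
    set p := levelProb μ X (Finset.range m) x
    set q := levelProb μ X (Finset.range (m - s)) x
    set R := levelProb μ X A x
    set e := s * (1 - margin μ X x)
    have hp0 : 0 ≤ p := levelProb_nonneg _ _
    have hp1 : p ≤ 1 := levelProb_le_one _ _
    have hR0 : 0 ≤ R := levelProb_nonneg _ _
    have hR1 : R ≤ 1 := levelProb_le_one _ _
    have e1 : |P - levelProb μ X (A ∪ B) x| ≤ e := abs_le.2 ⟨by linarith, by linarith⟩
    have e2 : |R * q - R * p| ≤ e := by
      rw [← mul_sub, abs_mul, abs_of_nonneg hR0]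
      calc R * |q - p| ≤ 1 * |q - p| := by gcongr
        _ ≤ e := by rw [one_mul]; exact abs_le.2 ⟨by linarith, by linarith⟩
    have e3 : |R * p - p ^ (k + 1 + 1)| ≤ k * (a + 2 * e) := by
      rw [pow_succ, ← sub_mul, abs_mul, abs_of_nonneg hp0]
      calc _ ≤ |R - p ^ (k + 1)| * 1 := by gcongr
        _ ≤ _ := by rw [mul_one]; exact ih
    have := abs_le.1 e1
    have := abs_le.1 e2
    have := abs_le.1 e3
    have := abs_le.1 h1
    push_cast
    exact abs_le.2 ⟨by linarith, by linarith⟩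

theorem measureReal_gt_and_gt (hs : StrictlyStationary μ X) (i j : ℕ) (x : ℝ) :
    μ.real {ω | x < X i ω ∧ x < X (i + j) ω} = μ.real {ω | x < X 0 ω ∧ x < X j ω} := by
  have hm : MeasurableSet {f : ℕ → ℝ | x < f 0 ∧ x < f j} :=
    (measurableSet_lt measurable_const (measurable_pi_apply 0)).inter
      (measurableSet_lt measurable_const (measurable_pi_apply j))
  have := (hs i).measure_mem_eq hm
  simp only [measureReal_def]
  congr 1
  convert this using 2
  · ext ω
    simp [add_comm]
  · rfl

/-- Bonferroni's inequality for the event that some variable exceeds the level. -/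
theorem levelProb_range_le (hX : ∀ i, Measurable (X i)) (hs : StrictlyStationary μ X)
    (m : ℕ) (x : ℝ) :
    levelProb μ X (Finset.range m) x ≤ 1 - m * (1 - margin μ X x) +
      m * ∑ j ∈ Finset.Ico 1 m, μ.real {ω | x < X 0 ω ∧ x < X j ω} := by
  induction m with
  | zero => simpa using levelProb_le_one _ _
  | succ m ih =>
    set S := ∑ j ∈ Finset.Ico 1 m, μ.real {ω | x < X 0 ω ∧ x < X j ω}
    have hS : S ≤ ∑ j ∈ Finset.Ico 1 (m + 1), μ.real {ω | x < X 0 ω ∧ x < X j ω} :=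
      Finset.sum_le_sum_of_subset_of_nonneg (Finset.Ico_subset_Ico le_rfl (Nat.le_succ m))
        fun _ _ _ => measureReal_nonneg
    set T := ∑ j ∈ Finset.Ico 1 (m + 1), μ.real {ω | x < X 0 ω ∧ x < X j ω} with hT
    -- The first exceedance occurs at index `m`. Its probability is at least the tail probability
    -- minus the joint exceedances with earlier indices, and stationarity turns these into pairs
    -- `(0, j)`.
    set D : Set Ω := {ω | (∀ i ∈ Finset.range m, X i ω ≤ x) ∧ x < X m ω} with hD
    have hDm : MeasurableSet D := by
      have : D = (⋂ i ∈ Finset.range m, {ω | X i ω ≤ x}) ∩ {ω | x < X m ω} := by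
        ext ω; simp [hD]
      rw [this]
      exact (Finset.measurableSet_biInter _ fun i _ => hX i measurableSet_Iic).inter
        (hX m measurableSet_Ioi)
    have h1 : levelProb μ X (Finset.range (m + 1)) x + μ.real D ≤
        levelProb μ X (Finset.range m) x := by
      rw [levelProb, ← measureReal_union _ hDm]
      · refine measureReal_mono fun ω hω i hi => ?_
        rcases hω with h | h
        · exact h i (Finset.range_subset_range.2 (Nat.le_succ m) hi)
        · exact h.1 i hi
      · exact Set.disjoint_left.2 fun ω h h' =>
          absurd h'.2 (not_lt.2 (h m (Finset.self_mem_range_succ m)))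
    have h2 : 1 - margin μ X x ≤ μ.real D +
        ∑ i ∈ Finset.range m, μ.real {ω | x < X i ω ∧ x < X m ω} := by
      rw [← measureReal_gt hX hs m x]
      have hsub : {ω | x < X m ω} ⊆
          D ∪ ⋃ i ∈ Finset.range m, {ω | x < X i ω ∧ x < X m ω} := by
        intro ω hω
        by_cases h : ∀ i ∈ Finset.range m, X i ω ≤ x
        · exact Or.inl ⟨h, hω⟩
        · push Not at h
          obtain ⟨i, hi, hx⟩ := h
          exact Or.inr (mem_iUnion₂.2 ⟨i, hi, hx, hω⟩)
      refine (measureReal_mono hsub).trans ((measureReal_union_le _ _).trans ?_)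
      gcongr
      exact measureReal_biUnion_finset_le _ _
    have h3 : ∑ i ∈ Finset.range m, μ.real {ω | x < X i ω ∧ x < X m ω} = T := by
      rw [hT, Finset.sum_Ico_eq_sum_range, ← Finset.sum_range_reflect]
      refine Finset.sum_congr (by simp) fun i hi => ?_
      have hi := Finset.mem_range.1 hi
      rw [← measureReal_gt_and_gt hs (m - 1 - i) (1 + i), show m - 1 - i + (1 + i) = m by omega]
    have h4 : (m : ℝ) * S ≤ m * T := by gcongr
    push_cast
    linarith

end LevelProb

/-! ### No jump of the limit law at its left endpoint -/

section MaxDomain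

variable {F H : ℝ → ℝ} {c d : ℕ → ℝ}

theorem exists_continuousAt_mem_Ioo {H : ℝ → ℝ} (hH : Monotone H) {a b : ℝ} (hab : a < b) :
    ∃ x ∈ Ioo a b, ContinuousAt H x := by
  obtain ⟨x, hx, hx'⟩ := (hH.countable_not_continuousAt.dense_compl ℝ).exists_between hab
  exact ⟨x, hx', not_not.1 hx⟩

/-- To the right of a point, a distribution function has continuity points with nearby values. -/
theorem exists_continuousAt_lt (hH : IsDistributionFunction H) {x b r : ℝ} (hr : H x < r)
    (hxb : x < b) : ∃ y ∈ Ioo x b, ContinuousAt H y ∧ H y < r := by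
  have h1 : ∀ᶠ y in 𝓝[>] x, H y < r :=
    ((hH.2.1 x).mono Ioi_subset_Ici_self).eventually (gt_mem_nhds hr)
  obtain ⟨z, hz, hz'⟩ := (mem_nhdsGT_iff_exists_Ioo_subset).1 h1
  have hz : x < z := hz
  obtain ⟨y, hy, hc⟩ := exists_continuousAt_mem_Ioo hH.1 (lt_min hz hxb)
  exact ⟨y, ⟨hy.1, hy.2.trans_le (min_le_right _ _)⟩, hc,
    hz' ⟨hy.1, hy.2.trans_le (min_le_left _ _)⟩⟩

theorem exists_pow_eq_of_mem_Ioo (hFc : Continuous F) (hF0 : Tendsto F atBot (𝓝 0))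
    (hF1 : Tendsto F atTop (𝓝 1)) {n : ℕ} (hn : n ≠ 0) {q : ℝ} (hq : q ∈ Ioo (0 : ℝ) 1) :
    ∃ y, F y ^ n = q := by
  have h0 : Tendsto (fun x => F x ^ n) atBot (𝓝 0) := by
    simpa [hn] using hF0.pow n
  have h1 : Tendsto (fun x => F x ^ n) atTop (𝓝 1) := by
    simpa using hF1.pow n
  obtain ⟨a, ha⟩ := (h0.eventually_lt_const hq.1).exists
  obtain ⟨b, hb⟩ := (h1.eventually_const_lt hq.2).exists
  exact mem_range_of_exists_le_of_exists_ge (hFc.pow n) ⟨a, ha.le⟩ ⟨b, hb.le⟩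

/-- A distribution function that attracts a continuous distribution function has no jump at its
left endpoint. -/
theorem InMDA.exists_pos_lt (hFm : Monotone F) (hFc : Continuous F) (hF0 : Tendsto F atBot (𝓝 0))
    (hF1 : Tendsto F atTop (𝓝 1)) (h : InMDA F H c d) {ε : ℝ} (hε : 0 < ε) :
    ∃ x, 0 < H x ∧ H x < ε ∧ ContinuousAt H x := by
  obtain ⟨hH, ⟨x₁, hx₁⟩, hc, hlim⟩ := h
  by_contra! hcon
  -- Otherwise `H` jumps from `0` to some `p ∈ [ε, 1)` at `x₀`. Comparing quantiles of `F^n` and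
  -- `F^{2n}` then shows that `c_{2n}/c_n` would have to be both bounded and arbitrarily large.
  have hgap : ∀ x, 0 < H x → ε ≤ H x := by
    intro x hx
    by_contra! hlt
    obtain ⟨y, hy, hyc, hyε⟩ := exists_continuousAt_lt hH hlt (lt_add_one x)
    exact hcon y (hx.trans_le (hH.1 hy.1.le)) hyε hyc
  have hnn : ∀ x, 0 ≤ H x := fun x => hH.1.le_of_tendsto hH.2.2.1 x
  obtain ⟨z, hz⟩ := (hH.2.2.1.eventually_lt_const hε).exists
  set S : Set ℝ := {x | 0 < H x} with hS
  have hz0 : ∀ x ∈ S, z ≤ x := by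
    intro x hx
    by_contra! hlt
    exact absurd ((hgap x hx).trans (hH.1 hlt.le)) (not_le.2 hz)
  set x₀ := sInf S with hx₀
  have hleft : ∀ x < x₀, H x = 0 := fun x hx =>
    le_antisymm (not_lt.1 fun h' => absurd (csInf_le ⟨z, hz0⟩ h') (not_le.2 hx)) (hnn x)
  have hright : ∀ x, x₀ < x → ε ≤ H x := by
    intro x hx
    obtain ⟨y, hy, hyx⟩ := exists_lt_of_csInf_lt ⟨x₁, hx₁.1⟩ hx
    exact (hgap y hy).trans (hH.1 hyx.le)
  have hp0 : 0 < H x₀ := by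
    by_contra! hle
    obtain ⟨y, hy, -, hyε⟩ := exists_continuousAt_lt hH (hle.trans_lt hε) (lt_add_one x₀)
    exact absurd (hright y hy.1) (not_le.2 hyε)
  have hp1 : H x₀ < 1 := (hH.1 (csInf_le ⟨z, hz0⟩ hx₁.1)).trans_lt hx₁.2
  set p := H x₀ with hp
  have hleftc : ∀ x < x₀, ContinuousAt H x := fun x hx =>
    (continuousAt_const (y := (0 : ℝ))).congr
      (by filter_upwards [Iio_mem_nhds hx] with y hy using (hleft y hy).symm)
  -- comparison of quantiles of `F ^ n` with the scaled points
  have hup : ∀ x q, ContinuousAt H x → H x < q →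
      ∀ᶠ n in atTop, ∀ y, F y ^ n = q → c n * x + d n < y := by
    intro x q hxc hxq
    filter_upwards [(hlim x hxc).eventually_lt_const hxq] with n hn y hy
    by_contra! hle
    exact absurd (hy ▸ pow_le_pow_left₀ (hFm.le_of_tendsto hF0 y) (hFm hle) n) (not_le.2 hn)
  have hlow : ∀ x q, ContinuousAt H x → q < H x →
      ∀ᶠ n in atTop, ∀ y, F y ^ n = q → y < c n * x + d n := by
    intro x q hxc hxq
    filter_upwards [(hlim x hxc).eventually_const_lt hxq] with n hn y hy
    by_contra! hle
    exact absurd (hy ▸ pow_le_pow_left₀ (hFm.le_of_tendsto hF0 _) (hFm hle) n) (not_le.2 hn)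
  have htwo : Tendsto (fun n : ℕ => n * 2) atTop atTop :=
    tendsto_id.atTop_mul_const' (by norm_num)
  -- The level `q` lies above the jump, while `q²` lies inside it. The quantiles of `F^n` at `p/2`
  -- and `q` are therefore separated on the scale `c_n` but merge on the scale `c_{2n}`.
  obtain ⟨q, hpq, hqp⟩ : ∃ q, p < q ∧ q < √p :=
    exists_between (Real.lt_sqrt_of_sq_lt (by nlinarith))
  have hq2 : q ^ 2 < p := (Real.lt_sqrt (hp0.trans hpq).le).1 hqp
  have hq1 : q < 1 := by nlinarith
  -- Here `r²` is still above the jump, so the quantiles at `p/2` and `r` stay separated on the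
  -- scale `c_{2n}`, and their distance is also `O(c_n)`. This bounds `c_{2n}/c_n`.
  obtain ⟨r, hpr, hr1⟩ : ∃ r, √p < r ∧ r < 1 :=
    exists_between (by rw [Real.sqrt_lt' one_pos]; simpa using hp1)
  have hr2 : p < r ^ 2 := (Real.sqrt_lt' ((Real.sqrt_nonneg p).trans_lt hpr)).1 hpr
  have hr0 : 0 < r := (Real.sqrt_nonneg p).trans_lt hpr
  obtain ⟨a₁, ha₁, ha₁c, ha₁q⟩ := exists_continuousAt_lt hH hpq (lt_add_one x₀)
  obtain ⟨b₁, hb₁, hb₁c⟩ := exists_continuousAt_mem_Ioo hH.1 ha₁.1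
  obtain ⟨a₂, ha₂, ha₂c, ha₂q⟩ := exists_continuousAt_lt hH hr2 (lt_add_one x₀)
  obtain ⟨b₂, hb₂, hb₂c⟩ := exists_continuousAt_mem_Ioo hH.1 ha₂.1
  obtain ⟨K, hKr, hKc⟩ : ∃ K, r < H K ∧ ContinuousAt H K := by
    obtain ⟨K, hK⟩ := (hH.2.2.2.eventually_const_lt hr1).exists
    obtain ⟨K', hK', hc'⟩ := exists_continuousAt_mem_Ioo hH.1 (lt_add_one K)
    exact ⟨K', hK.trans_le (hH.1 hK'.1.le), hc'⟩
  have hKx : x₀ < K := by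
    by_contra! hle
    have := hH.1 hle
    nlinarith
  set a₀ := x₀ - 1 with ha₀
  have ha₀x : a₀ < x₀ := sub_one_lt x₀
  have hden : 0 < K - a₀ := by linarith
  -- The value for which `c_n (a₁ - b₁) < c_{2n} δ` and `c_{2n} (a₂ - b₂) < c_n (K - a₀)` contradict
  -- each other.
  set δ := (a₁ - b₁) * (a₂ - b₂) / (K - a₀) with hδ
  have hδ0 : 0 < δ := div_pos (mul_pos (by linarith [hb₁.2]) (by linarith [hb₂.2])) hden
  obtain ⟨b₃, hb₃, hb₃c⟩ := exists_continuousAt_mem_Ioo hH.1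
    (show x₀ < x₀ + δ / 2 by linarith)
  set a₃ := x₀ - δ / 2 with ha₃
  have ha₃x : a₃ < x₀ := by linarith
  have hpH : ∀ x, x₀ < x → p ≤ H x := fun x hx => hH.1 hx.le
  have hy2 : (p / 2) ^ 2 < p := by nlinarith
  obtain ⟨n, hn1, hn⟩ := ((eventually_ge_atTop 1).and
    ((hup a₀ (p / 2) (hleftc _ ha₀x) (by rw [hleft _ ha₀x]; linarith)).and
    ((hlow b₁ (p / 2) hb₁c (by linarith [hpH b₁ hb₁.1])).and
    ((hup a₁ q ha₁c ha₁q).and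
    ((hlow K r hKc hKr).and
    ((htwo.eventually (hup a₃ ((p / 2) ^ 2) (hleftc _ ha₃x)
      (by rw [hleft _ ha₃x]; positivity))).and
    ((htwo.eventually (hlow b₂ ((p / 2) ^ 2) hb₂c (by linarith [hpH b₂ hb₂.1]))).and
    ((htwo.eventually (hlow b₃ (q ^ 2) hb₃c (by linarith [hpH b₃ hb₃.1]))).and
    (htwo.eventually (hup a₂ (r ^ 2) ha₂c ha₂q)))))))))).exists
  obtain ⟨e1, e2, e3, e4, e5, e6, e7, e8⟩ := hn
  have hn0 : n ≠ 0 := by omega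
  obtain ⟨y, hy⟩ := exists_pow_eq_of_mem_Ioo hFc hF0 hF1 hn0
    (show p / 2 ∈ Ioo (0 : ℝ) 1 from ⟨by linarith, by linarith⟩)
  obtain ⟨z, hz⟩ := exists_pow_eq_of_mem_Ioo hFc hF0 hF1 hn0
    (show q ∈ Ioo (0 : ℝ) 1 from ⟨by linarith, hq1⟩)
  obtain ⟨w, hw⟩ := exists_pow_eq_of_mem_Ioo hFc hF0 hF1 hn0
    (show r ∈ Ioo (0 : ℝ) 1 from ⟨hr0, hr1⟩)
  have hsq : ∀ x v, F x ^ n = v → F x ^ (n * 2) = v ^ 2 := fun x v h => by rw [pow_mul, h]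
  have e1 := e1 y hy
  have e2 := e2 y hy
  have e3 := e3 z hz
  have e4 := e4 w hw
  have e5 := e5 y (hsq y _ hy)
  have e6 := e6 y (hsq y _ hy)
  have e7 := e7 z (hsq z _ hz)
  have e8 := e8 w (hsq w _ hw)
  have hC := hc (n * 2) (by omega)
  have hcn := hc n hn1
  set C := c (n * 2)
  have f1 : c n * (a₁ - b₁) < C * δ := by
    have : C * (b₃ - a₃) ≤ C * δ := by
      gcongr
      linarith [hb₃.2]
    linarith
  have f2 : C * (a₂ - b₂) < c n * (K - a₀) := by linarith
  have f3 : δ * (K - a₀) = (a₁ - b₁) * (a₂ - b₂) := div_mul_cancel₀ _ hden.ne'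
  have g1 : c n * (a₁ - b₁) * (a₂ - b₂) < C * δ * (a₂ - b₂) :=
    mul_lt_mul_of_pos_right f1 (by linarith [hb₂.2])
  have g2 : C * (a₂ - b₂) * δ < c n * (K - a₀) * δ := mul_lt_mul_of_pos_right f2 hδ0
  have g3 : c n * (K - a₀) * δ = c n * (a₁ - b₁) * (a₂ - b₂) := by
    rw [mul_assoc, mul_comm (K - a₀), f3, mul_assoc]
  linarith

end MaxDomain

/-! ### Change of level, asymptotic block independence and the Poisson limit -/

section Mixing

variable {Ω : Type*} [MeasurableSpace Ω] {μ : Measure Ω} [IsProbabilityMeasure μ] {X : ℕ → Ω → ℝ}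

/-- With `L = -log f`, the bounds `1 - 1/f ≤ log f ≤ f - 1` give `L/(1+L) ≤ 1 - f ≤ L`. Multiplying
by `n` squeezes the sequence, since `nL = -log(f^n)` converges. -/
theorem tendsto_mul_one_sub_of_pow {f : ℕ → ℝ} (hf : ∀ n, f n ∈ Icc (0 : ℝ) 1) {v : ℝ}
    (hv : 0 < v) (h : Tendsto (fun n => f n ^ n) atTop (𝓝 v)) :
    Tendsto (fun n : ℕ => (n : ℝ) * (1 - f n)) atTop (𝓝 (-Real.log v)) := by
  have hA : Tendsto (fun n => -Real.log (f n ^ n)) atTop (𝓝 (-Real.log v)) :=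
    (h.log hv.ne').neg
  have hB : Tendsto (fun n : ℕ => -Real.log (f n ^ n) / (1 + -Real.log (f n ^ n) / n)) atTop
      (𝓝 (-Real.log v)) := by
    have := hA.div ((hA.div_atTop tendsto_natCast_atTop_atTop).const_add 1) (by norm_num)
    rw [add_zero, div_one] at this
    exact this
  refine tendsto_of_tendsto_of_tendsto_of_le_of_le' hB hA ?_ ?_
  · filter_upwards [h.eventually_const_lt hv, eventually_ge_atTop 1] with n hn hn1
    have hn0 : (0 : ℝ) < n := by exact_mod_cast hn1
    have hf0 : 0 < f n := (hf n).1.lt_of_ne fun h0 => by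
      rw [← h0, zero_pow (by omega)] at hn; exact lt_irrefl _ hn
    have hlog : Real.log (f n) ≤ 0 := Real.log_nonpos (hf n).1 (hf n).2
    rw [Real.log_pow]
    have e : -(n * Real.log (f n)) / n = -Real.log (f n) := by field_simp
    rw [e, div_le_iff₀ (by linarith)]
    have h1 := Real.one_sub_inv_le_log_of_pos hf0
    have h2 : f n * (1 - (f n)⁻¹) ≤ f n * Real.log (f n) := by gcongr
    rw [mul_sub, mul_inv_cancel₀ hf0.ne'] at h2
    nlinarith
  · filter_upwards [h.eventually_const_lt hv, eventually_ge_atTop 1] with n hn hn1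
    have hf0 : 0 < f n := (hf n).1.lt_of_ne fun h0 => by
      rw [← h0, zero_pow (by omega)] at hn; exact lt_irrefl _ hn
    rw [Real.log_pow]
    nlinarith [Real.log_le_sub_one_of_pos hf0, (Nat.cast_nonneg n : (0 : ℝ) ≤ n)]

theorem rpow_one_div_mem_Icc {v : ℝ} (hv : v ∈ Icc (0 : ℝ) 1) (n : ℕ) :
    v ^ (1 / (n : ℝ)) ∈ Icc (0 : ℝ) 1 :=
  ⟨Real.rpow_nonneg hv.1 _, Real.rpow_le_one hv.1 hv.2 (by positivity)⟩

theorem tendsto_mul_one_sub_rpow {v : ℝ} (hv : v ∈ Ioc (0 : ℝ) 1) :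
    Tendsto (fun n : ℕ => (n : ℝ) * (1 - v ^ (1 / (n : ℝ)))) atTop (𝓝 (-Real.log v)) := by
  refine tendsto_mul_one_sub_of_pow (rpow_one_div_mem_Icc ⟨hv.1.le, hv.2⟩) hv.1 ?_
  refine tendsto_const_nhds.congr' ?_
  filter_upwards [eventually_ge_atTop 1] with n hn
  rw [one_div, Real.rpow_inv_natCast_pow hv.1.le (by omega)]

theorem tendsto_copulaDiag_sub (hX : ∀ i, Measurable (X i)) (hs : StrictlyStationary μ X)
    (hF : Continuous (margin μ X)) {m : ℕ → ℕ} {a b : ℕ → ℝ} {σ : ℝ}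
    (ha : ∀ n, a n ∈ Icc (0 : ℝ) 1) (hb : ∀ n, b n ∈ Icc (0 : ℝ) 1)
    (ha' : Tendsto (fun n => (m n : ℝ) * (1 - a n)) atTop (𝓝 σ))
    (hb' : Tendsto (fun n => (m n : ℝ) * (1 - b n)) atTop (𝓝 σ)) :
    Tendsto (fun n => copulaDiag μ X (m n) (a n) - copulaDiag μ X (m n) (b n)) atTop (𝓝 0) := by
  have h : Tendsto (fun n => |(m n : ℝ) * (1 - b n) - (m n : ℝ) * (1 - a n)|) atTop (𝓝 0) := by
    simpa using (hb'.sub ha').abs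
  refine squeeze_zero_norm (fun n => ?_) h
  rw [Real.norm_eq_abs]
  refine (abs_copulaDiag_sub_le hX hs hF (m n) (ha n) (hb n)).trans_eq ?_
  rw [← mul_sub, abs_mul, Nat.abs_cast]
  congr 2
  ring

theorem tendsto_natDiv_div {k : ℕ} :
    Tendsto (fun n : ℕ => ((n / k : ℕ) : ℝ) / n) atTop (𝓝 (1 / k)) := by
  have h := (tendsto_nat_floor_mul_div_atTop (R := ℝ) (a := 1 / k) (by positivity)).comp
    tendsto_natCast_atTop_atTop
  refine h.congr fun n => ?_
  have : (1 / k * (n : ℝ)) = n / k := by ring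
  simp only [Function.comp_apply, this, Nat.floor_div_eq_div]

theorem tendsto_pow_sub_pow {a b : ℕ → ℝ} (ha : ∀ n, a n ∈ Icc (0 : ℝ) 1)
    (hb : ∀ n, b n ∈ Icc (0 : ℝ) 1) (h : Tendsto (fun n => a n - b n) atTop (𝓝 0)) (k : ℕ) :
    Tendsto (fun n => a n ^ k - b n ^ k) atTop (𝓝 0) := by
  have h' : Tendsto (fun n => |a n - b n| * k) atTop (𝓝 0) := by
    simpa using h.abs.mul_const (k : ℝ)
  refine squeeze_zero_norm (fun n => ?_) h'
  rw [Real.norm_eq_abs]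
  refine (abs_pow_sub_pow_le _ _ k).trans (mul_le_of_le_one_right (by positivity) ?_)
  refine pow_le_one₀ (by positivity) (max_le ?_ ?_)
  · rw [abs_of_nonneg (ha n).1]; exact (ha n).2
  · rw [abs_of_nonneg (hb n).1]; exact (hb n).2

/-- Asymptotic independence of `k` consecutive blocks of length `n / k` under the mixing
condition, at the levels `x (N n)` with `n ≤ N n = O(n)`. -/
theorem CondD.tendsto_levelProb_sub_pow (hX : ∀ i, Measurable (X i)) (hs : StrictlyStationary μ X)
    {x : ℕ → ℝ} (hD : CondD μ X x) {σ T : ℝ}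
    (hx : Tendsto (fun n : ℕ => (n : ℝ) * (1 - margin μ X (x n))) atTop (𝓝 σ))
    {N : ℕ → ℕ} (hN : ∀ n, n ≤ N n) (hT : Tendsto (fun n => (N n : ℝ) / n) atTop (𝓝 T))
    {k : ℕ} (hk : k ≠ 0) :
    Tendsto (fun n => levelProb μ X (Finset.range n) (x (N n)) -
      levelProb μ X (Finset.range (n / k)) (x (N n)) ^ k) atTop (𝓝 0) := by
  obtain ⟨α, hα, s, hs1, hso, hα0⟩ := hD
  have hNt : Tendsto N atTop atTop := tendsto_atTop_mono hN tendsto_id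
  have hsN : Tendsto (fun n : ℕ => (s n : ℝ) / n) atTop (𝓝 0) := hso.tendsto_div_nhds_zero
  have hsp : Tendsto (fun n : ℕ => (s n : ℝ) * (1 - margin μ X (x n))) atTop (𝓝 0) := by
    have := hsN.mul hx
    rw [zero_mul] at this
    refine this.congr' ?_
    filter_upwards [eventually_ge_atTop 1] with n hn
    have : (n : ℝ) ≠ 0 := by positivity
    field_simp
  have hp : Tendsto (fun n : ℕ => 1 - margin μ X (x n)) atTop (𝓝 0) := by
    refine (hx.div_atTop tendsto_natCast_atTop_atTop).congr' ?_
    filter_upwards [eventually_ge_atTop 1] with n hn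
    have : (n : ℝ) ≠ 0 := by positivity
    field_simp
  have hsn : Tendsto (fun n : ℕ => (s (N n) : ℝ) / n) atTop (𝓝 0) := by
    have := (hsN.comp hNt).mul hT
    rw [zero_mul] at this
    refine this.congr' ?_
    filter_upwards [eventually_ge_atTop 1] with n hn
    have h1 : (N n : ℝ) ≠ 0 := Nat.cast_ne_zero.2 (by have := hN n; omega)
    simp only [Function.comp_apply]
    field_simp
  -- Fewer than `k` indices are left over by the division, and `k - 1` blocks are added to the first
  -- one.
  have hbound : Tendsto (fun n => (k : ℝ) * (1 - margin μ X (x (N n))) +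
      ((k - 1 : ℕ) : ℝ) * (α (N n) (s (N n)) + 2 * (s (N n) * (1 - margin μ X (x (N n))))))
      atTop (𝓝 0) := by
    have := ((hp.comp hNt).const_mul (k : ℝ)).add
      (((hα0.comp hNt).add ((hsp.comp hNt).const_mul 2)).const_mul ((k - 1 : ℕ) : ℝ))
    simpa using this
  have hk0 : (0 : ℝ) < k := by positivity
  refine squeeze_zero_norm' ?_ hbound
  -- The factor `2` absorbs the floor: `n < 2k⌊n/k⌋` once `n ≥ k`, so the gap is shorter than a
  -- block.
  filter_upwards [hsn.eventually_lt_const (show (0 : ℝ) < 1 / (2 * k) by positivity),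
    eventually_ge_atTop k] with n hn hnk
  have hn0 : (0 : ℝ) < n := by exact_mod_cast (Nat.pos_of_ne_zero hk).trans_le hnk
  rw [div_lt_div_iff₀ hn0 (by positivity), one_mul] at hn
  have hn' : s (N n) * (2 * k) < n := by exact_mod_cast hn
  have hm1 : 1 ≤ n / k := Nat.div_pos hnk (Nat.pos_of_ne_zero hk)
  have hdm : n < k * (n / k) + k := Nat.lt_mul_div_succ n (Nat.pos_of_ne_zero hk)
  have hle : k * (n / k) ≤ n := Nat.mul_div_le n k
  have hsm : s (N n) < n / k := by
    by_contra! hcon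
    have : k * (n / k) ≤ k * s (N n) := Nat.mul_le_mul_left k hcon
    have : k * 1 ≤ k * (n / k) := Nat.mul_le_mul_left k hm1
    nlinarith
  have hblock := abs_levelProb_mul_sub_pow_le hX hs (hs1 (N n)) hsm (hα (N n) (s (N n)) (hs1 _))
    (k - 1) (by rw [Nat.sub_add_cancel (Nat.pos_of_ne_zero hk)]; exact hle.trans (hN n))
  rw [Nat.sub_add_cancel (Nat.pos_of_ne_zero hk)] at hblock
  have h1 : levelProb μ X (Finset.range n) (x (N n)) ≤
      levelProb μ X (Finset.range (k * (n / k))) (x (N n)) :=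
    levelProb_anti (Finset.range_subset_range.2 hle) _
  have h2 := levelProb_le_add hX hs (A := Finset.range (k * (n / k))) (B := Finset.range n)
    (C := (Finset.range k).map (addRightEmbedding (k * (n / k)))) (fun j hj => by
      have hj := Finset.mem_range.1 hj
      simp only [Finset.mem_union, Finset.mem_map, Finset.mem_range, addRightEmbedding_apply]
      by_cases h1 : j < k * (n / k)
      · exact Or.inl h1
      · exact Or.inr ⟨j - k * (n / k), by omega, by omega⟩) (x (N n))
  rw [Finset.card_map, Finset.card_range] at h2
  have h3 := abs_le.1 hblock
  rw [Real.norm_eq_abs]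
  have hp0 : 0 ≤ (k : ℝ) * (1 - margin μ X (x (N n))) :=
    mul_nonneg hk0.le (sub_nonneg.2 (margin_mem_Icc _).2)
  exact abs_le.2 ⟨by linarith, by linarith⟩

/-- The level is read at the later time `N n = ⌈Tn⌉` with `T = log u / log v`. This divides the
limiting rate `-log u` by `T` and gives `-log v`. The restriction `v ≥ u` means `T ≥ 1`, so the
first `n` indices are covered by the mixing bound at time `N n`. -/
theorem CondD.tendsto_diagPowerDistortion_sub_pow (hX : ∀ i, Measurable (X i))
    (hs : StrictlyStationary μ X) (hF : Continuous (margin μ X)) {x : ℕ → ℝ} (hD : CondD μ X x)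
    {u : ℝ} (hu : u ∈ Ioo (0 : ℝ) 1)
    (hx : Tendsto (fun n => margin μ X (x n) ^ n) atTop (𝓝 u)) {v : ℝ} (hv : v ∈ Ico u 1)
    {k : ℕ} (hk : k ≠ 0) :
    Tendsto (fun n => diagPowerDistortion μ X (fun n => (n : ℝ)) n v -
      diagPowerDistortion μ X (fun n => (n : ℝ)) (n / k) (v ^ (1 / (k : ℝ))) ^ k)
      atTop (𝓝 0) := by
  have hv0 : 0 < v := hu.1.trans_le hv.1
  have hlogu : Real.log u < 0 := Real.log_neg hu.1 hu.2
  have hlogv : Real.log v < 0 := Real.log_neg hv0 hv.2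
  have hloguv : Real.log u ≤ Real.log v := Real.log_le_log hu.1 hv.1
  set T := Real.log u / Real.log v with hT
  have hT1 : 1 ≤ T := by rw [hT, one_le_div_of_neg hlogv]; exact hloguv
  have hrate := tendsto_mul_one_sub_of_pow (fun n => margin_mem_Icc (x n)) hu.1 hx
  set N : ℕ → ℕ := fun n => ⌈T * (n : ℝ)⌉₊ with hN
  have hnN : ∀ n, n ≤ N n := fun n => by
    have : (n : ℝ) ≤ N n := le_trans (by nlinarith [(Nat.cast_nonneg n : (0 : ℝ) ≤ n)])
      (Nat.le_ceil (T * (n : ℝ)))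
    exact_mod_cast this
  have hNT : Tendsto (fun n => (N n : ℝ) / n) atTop (𝓝 T) :=
    (tendsto_nat_ceil_mul_div_atTop (R := ℝ) (zero_le_one.trans hT1)).comp
      tendsto_natCast_atTop_atTop
  have hNt : Tendsto N atTop atTop := tendsto_atTop_mono hnN tendsto_id
  have hnp : Tendsto (fun n : ℕ => (n : ℝ) * (1 - margin μ X (x (N n)))) atTop
      (𝓝 (-Real.log v)) := by
    have h := (hrate.comp hNt).div hNT (by positivity)
    have e : -Real.log u / T = -Real.log v := by
      rw [hT, neg_div, div_div_cancel₀ hlogu.ne]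
    rw [e] at h
    refine h.congr' ?_
    filter_upwards [eventually_ge_atTop 1] with n hn
    have h1 : (N n : ℝ) ≠ 0 := Nat.cast_ne_zero.2 (by have := hnN n; omega)
    have h2 : (n : ℝ) ≠ 0 := by positivity
    simp only [Pi.div_apply, Function.comp_apply]
    field_simp
  have hk0 : (0 : ℝ) < k := by positivity
  have hw : v ^ (1 / (k : ℝ)) ∈ Ioc (0 : ℝ) 1 :=
    ⟨Real.rpow_pos_of_pos hv0 _, (rpow_one_div_mem_Icc ⟨hv0.le, hv.2.le⟩ k).2⟩
  have hmp : Tendsto (fun n : ℕ => ((n / k : ℕ) : ℝ) * (1 - margin μ X (x (N n)))) atTop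
      (𝓝 (-Real.log (v ^ (1 / (k : ℝ))))) := by
    have h := (tendsto_natDiv_div (k := k)).mul hnp
    rw [Real.log_rpow hv0, ← mul_neg]
    refine h.congr' ?_
    filter_upwards [eventually_ge_atTop 1] with n hn
    have h2 : (n : ℝ) ≠ 0 := by positivity
    field_simp
  have hmw := (tendsto_mul_one_sub_rpow hw).comp (Nat.tendsto_div_const_atTop hk)
  have h1 := tendsto_copulaDiag_sub hX hs hF (m := fun n => n)
    (fun n => margin_mem_Icc (x (N n))) (fun n => rpow_one_div_mem_Icc ⟨hv0.le, hv.2.le⟩ n) hnp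
    (tendsto_mul_one_sub_rpow ⟨hv0, hv.2.le⟩)
  have h2 := tendsto_pow_sub_pow (fun n => ⟨copulaDiag_nonneg _ _, copulaDiag_le_one _ _⟩)
    (fun n => ⟨copulaDiag_nonneg _ _, copulaDiag_le_one _ _⟩)
    (tendsto_copulaDiag_sub hX hs hF (m := fun n => n / k)
      (fun n => margin_mem_Icc (x (N n)))
      (fun n => rpow_one_div_mem_Icc ⟨hw.1.le, hw.2⟩ (n / k)) hmp hmw) k
  have h3 := hD.tendsto_levelProb_sub_pow hX hs hrate hnN hNT hk
  have h4 := (h3.sub h1).add h2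
  simp only [copulaDiag_margin hX hs hF] at h4
  rw [sub_zero, add_zero] at h4
  refine h4.congr fun n => ?_
  simp only [diagPowerDistortion]
  ring

/-- The mixing and the anticlustering condition together force the Poisson limit. -/
theorem CondD.tendsto_levelProb_of_condD' (hX : ∀ i, Measurable (X i))
    (hs : StrictlyStationary μ X) {x : ℕ → ℝ} (hD : CondD μ X x) (hD' : CondD' μ X x) {τ : ℝ}
    (hx : Tendsto (fun n : ℕ => (n : ℝ) * (1 - margin μ X (x n))) atTop (𝓝 τ)) :
    Tendsto (fun n => levelProb μ X (Finset.range n) (x n)) atTop (𝓝 (Real.exp (-τ))) := by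
  have key : ∀ ε > 0, ∀ᶠ n in atTop,
      Real.exp (-(τ + ε)) - 2 * ε ≤ levelProb μ X (Finset.range n) (x n) ∧
        levelProb μ X (Finset.range n) (x n) ≤ Real.exp (-(τ - 2 * ε)) + ε := by
    intro ε hε
    -- A single block stays below the level with probability between `1 - (τ + ε)/k` (union bound)
    -- and `1 - (τ - 2ε)/k` (Bonferroni with anticlustering). The `k`-th powers of these are
    -- compared with exponentials for one large fixed `k`.
    have hexp : Tendsto (fun k : ℕ => (1 + -(τ + ε) / (k : ℝ)) ^ k) atTop
        (𝓝 (Real.exp (-(τ + ε)))) := Real.tendsto_one_add_div_pow_exp _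
    obtain ⟨k, hk1, hk2, hk3, hk4⟩ := ((eventually_ge_atTop 1).and
      ((hexp.eventually_const_lt (sub_lt_self _ hε)).and
      ((hD'.eventually_lt_const (ENNReal.ofReal_pos.2 hε)).and
      (tendsto_natCast_atTop_atTop.eventually_ge_atTop (max (τ + ε) (τ - 2 * ε)))))).exists
    have hk0 : (0 : ℝ) < k := by exact_mod_cast hk1
    have hmp : Tendsto (fun n : ℕ => ((n / k : ℕ) : ℝ) * (1 - margin μ X (x n))) atTop
        (𝓝 (1 / k * τ)) := by
      refine ((tendsto_natDiv_div (k := k)).mul hx).congr' ?_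
      filter_upwards [eventually_ge_atTop 1] with n hn
      have h2 : (n : ℝ) ≠ 0 := by positivity
      field_simp
    have hT : Tendsto (fun n : ℕ => (n : ℝ) / n) atTop (𝓝 1) := by
      refine tendsto_const_nhds.congr' ?_
      filter_upwards [eventually_ge_atTop 1] with n hn
      exact (div_self (by positivity)).symm
    have hblock := hD.tendsto_levelProb_sub_pow hX hs hx (N := fun n => n) (fun n => le_rfl) hT
      (k := k) (by omega)
    filter_upwards [eventually_lt_of_limsup_lt hk3,
      hmp.eventually_const_lt (show (τ - ε) / k < 1 / k * τ by
        rw [div_mul_eq_mul_div, one_mul]; gcongr; linarith),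
      hmp.eventually_lt_const (show 1 / k * τ < (τ + ε) / k by
        rw [div_mul_eq_mul_div, one_mul]; gcongr; linarith),
      hblock.eventually_const_lt (neg_lt_zero.2 hε), hblock.eventually_lt_const hε]
      with n h1 h2 h3 h4 h5
    set S := ∑ j ∈ Finset.Ico 1 (n / k), μ.real {ω | x n < X 0 ω ∧ x n < X j ω}
    have hS : (n : ℝ) * S < ε := by
      have := ENNReal.toReal_lt_of_lt_ofReal h1
      rwa [ENNReal.toReal_mul, ENNReal.toReal_natCast,
        ENNReal.toReal_sum fun _ _ => measure_ne_top _ _] at this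
    have hS0 : 0 ≤ S := Finset.sum_nonneg fun _ _ => measureReal_nonneg
    have hmS : ((n / k : ℕ) : ℝ) * S ≤ ε / k := by
      have h6 : ((n / k : ℕ) : ℝ) ≤ n / k := Nat.cast_div_le
      calc _ ≤ (n : ℝ) / k * S := by gcongr
        _ = n * S / k := by ring
        _ ≤ ε / k := by gcongr
    set P := levelProb μ X (Finset.range (n / k)) (x n) with hP
    have hlow : 1 + -(τ + ε) / k ≤ P := by
      have h6 := levelProb_le_add hX hs (A := ∅) (B := Finset.range (n / k))
        (C := Finset.range (n / k)) (by simp) (x n)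
      have h7 : levelProb μ X ∅ (x n) = 1 := by simp [levelProb]
      rw [h7, Finset.card_range] at h6
      rw [neg_div]
      linarith
    have hup : P ≤ 1 - (τ - 2 * ε) / k := by
      have h6 := levelProb_range_le hX hs (n / k) (x n)
      have h7 : (τ - 2 * ε) / k = (τ - ε) / k - ε / k := by ring
      linarith
    have hnonneg : 0 ≤ 1 + -(τ + ε) / k := by
      have : (τ + ε) / k ≤ 1 := (div_le_one hk0).2 ((le_max_left _ _).trans hk4)
      rw [neg_div]
      linarith
    have h6 := pow_le_pow_left₀ hnonneg hlow k
    have h7 := (pow_le_pow_left₀ (levelProb_nonneg _ _) hup k).trans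
      (Real.one_sub_div_pow_le_exp_neg ((le_max_right _ _).trans hk4))
    exact ⟨by linarith, by linarith⟩
  have c1 : Tendsto (fun ε : ℝ => Real.exp (-(τ + ε)) - 2 * ε) (𝓝[>] 0)
      (𝓝 (Real.exp (-τ))) := by
    have : Continuous fun ε : ℝ => Real.exp (-(τ + ε)) - 2 * ε := by fun_prop
    simpa using (this.tendsto 0).mono_left nhdsWithin_le_nhds
  have c2 : Tendsto (fun ε : ℝ => Real.exp (-(τ - 2 * ε)) + ε) (𝓝[>] 0)
      (𝓝 (Real.exp (-τ))) := by
    have : Continuous fun ε : ℝ => Real.exp (-(τ - 2 * ε)) + ε := by fun_prop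
    simpa using (this.tendsto 0).mono_left nhdsWithin_le_nhds
  refine tendsto_order.2 ⟨fun a ha => ?_, fun a ha => ?_⟩
  · obtain ⟨ε, h1, h2⟩ := ((c1.eventually_const_lt ha).and self_mem_nhdsWithin).exists
    filter_upwards [key ε h2] with n hn using h1.trans_le hn.1
  · obtain ⟨ε, h1, h2⟩ := ((c2.eventually_lt_const ha).and self_mem_nhdsWithin).exists
    filter_upwards [key ε h2] with n hn using hn.2.trans_lt h1

end Mixing

/-! ### From one limit value to the power diagonal, its index and the extremal index -/

section PowerLimit

variable {Ω : Type*} [MeasurableSpace Ω] {μ : Measure Ω} [IsProbabilityMeasure μ] {X : ℕ → Ω → ℝ}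

theorem diagPowerDistortion_mono {r : ℕ → ℝ} {n : ℕ} (hr : 0 ≤ r n) {v w : ℝ} (hv : 0 ≤ v)
    (hvw : v ≤ w) : diagPowerDistortion μ X r n v ≤ diagPowerDistortion μ X r n w :=
  copulaDiag_mono n (Real.rpow_le_rpow hv hvw (one_div_nonneg.2 hr))

theorem diagPowerDistortion_nonneg (r : ℕ → ℝ) (n : ℕ) (v : ℝ) :
    0 ≤ diagPowerDistortion μ X r n v := measureReal_nonneg

theorem tendsto_diagPowerDistortion_rpow
    (hmix : ∀ v ∈ Ioo (0 : ℝ) 1, ∀ k : ℕ, k ≠ 0 →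
      Tendsto (fun n => diagPowerDistortion μ X (fun n => (n : ℝ)) n v -
        diagPowerDistortion μ X (fun n => (n : ℝ)) (n / k) (v ^ (1 / (k : ℝ))) ^ k)
        atTop (𝓝 0))
    {u γ : ℝ} (hu : u ∈ Ioo (0 : ℝ) 1) (hγ : γ ∈ Ioo (0 : ℝ) 1)
    (hlim : Tendsto (fun n => diagPowerDistortion μ X (fun n => (n : ℝ)) n u) atTop (𝓝 γ))
    {t : ℝ} (ht : 0 < t) :
    Tendsto (fun n => diagPowerDistortion μ X (fun n => (n : ℝ)) n (u ^ t)) atTop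
      (𝓝 (γ ^ t)) := by
  have hroot : ∀ k : ℕ, k ≠ 0 →
      Tendsto (fun n => diagPowerDistortion μ X (fun n => (n : ℝ)) n (u ^ (1 / (k : ℝ))))
        atTop (𝓝 (γ ^ (1 / (k : ℝ)))) := by
    intro k hk
    have h1 := hlim.sub (hmix u hu k hk)
    simp only [sub_sub_cancel, sub_zero] at h1
    -- Along the multiples `nk` the block length is exactly `n`, so the full sequence at `u^{1/k}`
    -- is recovered.
    have h2 := h1.comp (tendsto_id.atTop_mul_const' (Nat.pos_of_ne_zero hk) :
      Tendsto (fun n : ℕ => n * k) atTop atTop)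
    refine (h2.rpow_const (p := 1 / (k : ℝ)) (Or.inr (by positivity))).congr fun n => ?_
    simp only [Function.comp_apply, Nat.mul_div_cancel _ (Nat.pos_of_ne_zero hk)]
    have h3 := Real.pow_rpow_inv_natCast
      (diagPowerDistortion_nonneg (μ := μ) (X := X) (fun n => (n : ℝ)) n (u ^ (1 / (k : ℝ)))) hk
    rwa [← one_div] at h3
  have hrat : ∀ q : ℚ, 0 < q →
      Tendsto (fun n => diagPowerDistortion μ X (fun n => (n : ℝ)) n (u ^ (q : ℝ)))
        atTop (𝓝 (γ ^ (q : ℝ))) := by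
    intro q hq
    obtain ⟨j, hj⟩ : ∃ j : ℕ, q.num = j := Int.eq_ofNat_of_zero_le (Rat.num_pos.2 hq).le
    have hj0 : j ≠ 0 := by
      have := Rat.num_pos.2 hq
      omega
    have hqe : (q : ℝ) = 1 / (q.den : ℝ) * j := by
      rw [Rat.cast_def, hj]; push_cast; ring
    have hmem : u ^ (q : ℝ) ∈ Ioo (0 : ℝ) 1 :=
      ⟨Real.rpow_pos_of_pos hu.1 _, Real.rpow_lt_one hu.1.le hu.2 (by exact_mod_cast hq)⟩
    have e : (u ^ (q : ℝ)) ^ (1 / (j : ℝ)) = u ^ (1 / (q.den : ℝ)) := by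
      rw [← Real.rpow_mul hu.1.le, hqe]
      congr 1
      field_simp
    -- For `q = j/den`, splitting into `j` blocks reduces `u^q` to `u^{1/den}`, whose limit is known
    -- from `hroot`.
    have h1 := hmix _ hmem j hj0
    rw [e] at h1
    have h2 := h1.add (((hroot q.den q.den_ne_zero).comp
      (Nat.tendsto_div_const_atTop hj0)).pow j)
    simp only [Function.comp_apply, sub_add_cancel, zero_add] at h2
    rwa [← Real.rpow_mul_natCast hγ.1.le, ← hqe] at h2
  have hcont : ContinuousAt (fun s : ℝ => γ ^ s) t := Real.continuousAt_const_rpow hγ.1.ne'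
  -- Rational exponents on either side of `t` sandwich the value. Since `u < 1`, a larger exponent
  -- gives the lower bound.
  refine tendsto_order.2 ⟨fun a ha => ?_, fun a ha => ?_⟩
  · obtain ⟨b, hb, hb'⟩ := (mem_nhdsGE_iff_exists_Ico_subset).1
      (nhdsWithin_le_nhds (s := Ici t) (hcont.eventually_const_lt ha))
    obtain ⟨q, hq1, hq2⟩ := exists_rat_btwn (show t < b from hb)
    have hq0 : 0 < q := by exact_mod_cast ht.trans hq1
    filter_upwards [(hrat q hq0).eventually_const_lt (hb' ⟨hq1.le, hq2⟩)] with n hn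
    exact hn.trans_le (diagPowerDistortion_mono (Nat.cast_nonneg n)
      (Real.rpow_nonneg hu.1.le _) (Real.rpow_le_rpow_of_exponent_ge hu.1 hu.2.le hq1.le))
  · obtain ⟨b, hb, hb'⟩ := (mem_nhdsLE_iff_exists_Ioc_subset).1
      (nhdsWithin_le_nhds (s := Iic t) (hcont.eventually_lt_const ha))
    obtain ⟨q, hq1, hq2⟩ := exists_rat_btwn (max_lt (show b < t from hb) ht)
    have hq0 : 0 < q := by exact_mod_cast (le_max_right b 0).trans_lt hq1
    filter_upwards [(hrat q hq0).eventually_lt_const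
      (hb' ⟨(le_max_left b 0).trans_lt hq1, hq2.le⟩)] with n hn
    exact lt_of_le_of_lt (diagPowerDistortion_mono (Nat.cast_nonneg n)
      (Real.rpow_nonneg hu.1.le _) (Real.rpow_le_rpow_of_exponent_ge hu.1 hu.2.le hq2.le)) hn

theorem hasAsymptoticPowerDiagonalWithRate_of_tendsto (hX : ∀ i, Measurable (X i))
    (hs : StrictlyStationary μ X) (hF : Continuous (margin μ X))
    (hmix : ∀ v ∈ Ioo (0 : ℝ) 1, ∀ k : ℕ, k ≠ 0 →
      Tendsto (fun n => diagPowerDistortion μ X (fun n => (n : ℝ)) n v -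
        diagPowerDistortion μ X (fun n => (n : ℝ)) (n / k) (v ^ (1 / (k : ℝ))) ^ k)
        atTop (𝓝 0))
    {u γ : ℝ} (hu : u ∈ Ioo (0 : ℝ) 1) (hγ : γ ∈ Ioo (0 : ℝ) 1)
    (hlim : Tendsto (fun n => diagPowerDistortion μ X (fun n => (n : ℝ)) n u) atTop (𝓝 γ)) :
    HasAsymptoticPowerDiagonalWithRate μ X (fun n => (n : ℝ)) (Real.log γ / Real.log u) := by
  have hlogu : Real.log u < 0 := Real.log_neg hu.1 hu.2
  have hlogγ : Real.log γ < 0 := Real.log_neg hγ.1 hγ.2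
  have hθ : 0 < Real.log γ / Real.log u := div_pos_of_neg_of_neg hlogγ hlogu
  refine ⟨hθ, fun n hn => Nat.cast_pos.2 hn, tendsto_natCast_atTop_atTop, fun v hv => ?_⟩
  rcases hv.1.eq_or_lt with rfl | hv0
  · rw [Real.zero_rpow hθ.ne']
    refine tendsto_const_nhds.congr' ?_
    filter_upwards [eventually_ge_atTop 1] with n hn
    have : (1 / (n : ℝ)) ≠ 0 := by positivity
    rw [diagPowerDistortion, Real.zero_rpow this, copulaDiag_zero hX hs hF hn]
  rcases hv.2.eq_or_lt with rfl | hv1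
  · simp only [diagPowerDistortion, Real.one_rpow, copulaDiag_one]
    exact tendsto_const_nhds
  have hlogv : Real.log v < 0 := Real.log_neg hv0 hv1
  have h := tendsto_diagPowerDistortion_rpow hmix hu hγ hlim (div_pos_of_neg_of_neg hlogv hlogu)
  have e1 : u ^ (Real.log v / Real.log u) = v := by
    rw [Real.rpow_def_of_pos hu.1, mul_div_cancel₀ _ hlogu.ne, Real.exp_log hv0]
  have e2 : γ ^ (Real.log v / Real.log u) = v ^ (Real.log γ / Real.log u) := by
    rw [Real.rpow_def_of_pos hγ.1, Real.rpow_def_of_pos hv0]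
    congr 1
    ring
  rwa [e1, e2] at h

/-- The index belonging to the rate `n` is at most one. -/
theorem HasAsymptoticPowerDiagonalWithRate.index_le_one (hX : ∀ i, Measurable (X i))
    (hs : StrictlyStationary μ X) (hF : Continuous (margin μ X)) {θ : ℝ}
    (h : HasAsymptoticPowerDiagonalWithRate μ X (fun n => (n : ℝ)) θ) : θ ≤ 1 := by
  have hθ := h.1
  -- The limit of the union bound `1 - n(1 - v^{1/n}) ≤ D_n(v)` at `v = e^{-s}`.
  have key : ∀ s > 0, 1 - s ≤ Real.exp (-(s * θ)) := by
    intro s hs0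
    have hv : Real.exp (-s) ∈ Ioc (0 : ℝ) 1 := ⟨Real.exp_pos _, by simpa using hs0.le⟩
    have h1 := (tendsto_mul_one_sub_rpow hv).const_sub 1
    have h2 := h.2.2.2 _ ⟨hv.1.le, hv.2⟩
    rw [Real.log_exp, neg_neg] at h1
    rw [← Real.exp_mul, neg_mul] at h2
    refine le_of_tendsto_of_tendsto' h1 h2 fun n => ?_
    have hm := rpow_one_div_mem_Icc ⟨hv.1.le, hv.2⟩ n
    have := copulaDiag_le_add hX hs hF n hm (right_mem_Icc.2 zero_le_one) hm.2
    rw [copulaDiag_one] at this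
    rw [diagPowerDistortion]
    linarith
  by_contra! hlt
  -- For this `s`, `(1 + sθ)(1 - s) - 1 = s(θ - 1)/2 > 0`, against the bound `h6`.
  set s := (θ - 1) / (2 * θ) with hs'
  have hs0 : 0 < s := div_pos (by linarith) (by linarith)
  have h1 := key s hs0
  have h2 := Real.add_one_le_exp (s * θ)
  have h3 : Real.exp (s * θ) * Real.exp (-(s * θ)) = 1 := by rw [← Real.exp_add]; simp
  have h4 : s * θ = (θ - 1) / 2 := by rw [hs']; field_simp
  have h5 : s < 1 := by rw [hs', div_lt_one (by linarith)]; linarith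
  have h6 : (s * θ + 1) * (1 - s) ≤ 1 := by
    exact (mul_le_mul h2 h1 (by linarith) (Real.exp_pos _).le).trans h3.le
  nlinarith

/-- Convergence of monotone functions to a continuous limit is continuous convergence. -/
theorem tendsto_apply_of_monotone {g : ℕ → ℝ → ℝ} {G : ℝ → ℝ} (hg : ∀ n, Monotone (g n))
    (hlim : ∀ y, Tendsto (fun n => g n y) atTop (𝓝 (G y))) {y : ℕ → ℝ} {y₀ : ℝ}
    (hG : ContinuousAt G y₀) (hy : Tendsto y atTop (𝓝 y₀)) :
    Tendsto (fun n => g n (y n)) atTop (𝓝 (G y₀)) := by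
  refine tendsto_order.2 ⟨fun a ha => ?_, fun a ha => ?_⟩
  · obtain ⟨z, h1, h2⟩ := (((hG.eventually_const_lt ha).filter_mono
      (nhdsWithin_le_nhds (s := Iio y₀))).and self_mem_nhdsWithin).exists
    filter_upwards [(hlim z).eventually_const_lt h1, hy.eventually_const_lt h2] with n h3 h4
    exact h3.trans_le (hg n h4.le)
  · obtain ⟨z, h1, h2⟩ := (((hG.eventually_lt_const ha).filter_mono
      (nhdsWithin_le_nhds (s := Ioi y₀))).and self_mem_nhdsWithin).exists
    filter_upwards [(hlim z).eventually_lt_const h1, hy.eventually_lt_const h2] with n h3 h4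
    exact lt_of_le_of_lt (hg n h4.le) h3

theorem HasAsymptoticPowerDiagonalWithRate.tendsto_apply {θ : ℝ}
    (h : HasAsymptoticPowerDiagonalWithRate μ X (fun n => (n : ℝ)) θ) {y : ℕ → ℝ} {y₀ : ℝ}
    (hy : ∀ n, y n ∈ Icc (0 : ℝ) 1) (hlim : Tendsto y atTop (𝓝 y₀)) :
    Tendsto (fun n => diagPowerDistortion μ X (fun n => (n : ℝ)) n (y n)) atTop
      (𝓝 (y₀ ^ θ)) := by
  have hy₀ : y₀ ∈ Icc (0 : ℝ) 1 := isClosed_Icc.mem_of_tendsto hlim (Eventually.of_forall hy)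
  -- Clamping to `[0,1]` makes the distortions monotone and convergent on all of `ℝ`, as
  -- `tendsto_apply_of_monotone` requires.
  have hcl : ∀ z ∈ Icc (0 : ℝ) 1, max 0 (min z 1) = z := fun z hz => by
    rw [min_eq_left hz.2, max_eq_right hz.1]
  have hmem : ∀ z : ℝ, max 0 (min z 1) ∈ Icc (0 : ℝ) 1 := fun z =>
    ⟨le_max_left _ _, max_le zero_le_one (min_le_right _ _)⟩
  have := tendsto_apply_of_monotone
    (g := fun n z => diagPowerDistortion μ X (fun n => (n : ℝ)) n (max 0 (min z 1)))
    (G := fun z => (max 0 (min z 1)) ^ θ)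
    (fun n z w hzw => diagPowerDistortion_mono (Nat.cast_nonneg n) (hmem z).1
      (max_le_max le_rfl (min_le_min hzw le_rfl)))
    (fun z => h.2.2.2 _ (hmem z))
    (((by fun_prop : Continuous fun z : ℝ => max 0 (min z 1)).rpow_const
      fun _ => Or.inr h.1.le).continuousAt (x := y₀)) hlim
  simpa only [hcl _ (hy _), hcl _ hy₀] using this

theorem HasAsymptoticPowerDiagonalWithRate.tendstoInLaw (hX : ∀ i, Measurable (X i))
    (hs : StrictlyStationary μ X) (hF : Continuous (margin μ X)) {H : ℝ → ℝ} {c d : ℕ → ℝ}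
    (hMDA : InMDA (margin μ X) H c d) {θ : ℝ}
    (h : HasAsymptoticPowerDiagonalWithRate μ X (fun n => (n : ℝ)) θ) :
    TendstoInLaw μ (fun n ω => (runMax X n ω - d n) / c n) (fun x => H x ^ θ) := by
  intro x hx
  obtain ⟨hH, -, hc, hlim⟩ := hMDA
  have hnn : ∀ x, 0 ≤ H x := fun x => hH.1.le_of_tendsto hH.2.2.1 x
  -- Continuity points of `H ^ θ` are continuity points of `H`, because the power can be inverted.
  have hHx : ContinuousAt H x := by
    have h1 : ContinuousAt (fun x => (H x ^ θ) ^ θ⁻¹) x :=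
      hx.rpow_const (Or.inr (inv_nonneg.2 h.1.le))
    have h2 : (fun x => (H x ^ θ) ^ θ⁻¹) = H := by
      funext y
      exact Real.rpow_rpow_inv (hnn y) h.1.ne'
    rwa [h2] at h1
  have hF01 : ∀ n, margin μ X (c n * x + d n) ^ n ∈ Icc (0 : ℝ) 1 := fun n =>
    ⟨pow_nonneg (margin_mem_Icc _).1 _, pow_le_one₀ (margin_mem_Icc _).1 (margin_mem_Icc _).2⟩
  refine (h.tendsto_apply hF01 (hlim x hHx)).congr' ?_
  filter_upwards [eventually_ge_atTop 1] with n hn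
  have e : {ω | (runMax X n ω - d n) / c n ≤ x} = {ω | runMax X n ω ≤ c n * x + d n} := by
    ext ω
    simp only [mem_ofPred_eq]
    rw [div_le_iff₀ (hc n hn), sub_le_iff_le_add, mul_comm]
  rw [e, runMax_eq_copulaDiag hX hs hF hn, diagPowerDistortion, one_div,
    Real.pow_rpow_inv_natCast (margin_mem_Icc _).1 (by omega)]

/-- For each `v`, a continuity point with `0 < H x < v` provides admissible levels. -/
theorem InMDA.tendsto_diagPowerDistortion_sub_pow (hX : ∀ i, Measurable (X i))
    (hs : StrictlyStationary μ X) (hF : Continuous (margin μ X)) {H : ℝ → ℝ} {c d : ℕ → ℝ}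
    (hMDA : InMDA (margin μ X) H c d)
    (hD : ∀ x, 0 < H x → CondD μ X (fun n => c n * x + d n)) :
    ∀ v ∈ Ioo (0 : ℝ) 1, ∀ k : ℕ, k ≠ 0 →
      Tendsto (fun n => diagPowerDistortion μ X (fun n => (n : ℝ)) n v -
        diagPowerDistortion μ X (fun n => (n : ℝ)) (n / k) (v ^ (1 / (k : ℝ))) ^ k)
        atTop (𝓝 0) := by
  intro v hv k hk
  obtain ⟨x, hx0, hxv, hxc⟩ := hMDA.exists_pos_lt margin_mono hF (tendsto_cdf_atBot _)
    (tendsto_cdf_atTop _) hv.1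
  exact (hD x hx0).tendsto_diagPowerDistortion_sub_pow hX hs hF ⟨hx0, hxv.trans hv.2⟩
    (hMDA.2.2.2 x hxc) ⟨hxv.le, hv.2⟩ hk

end PowerLimit

end CopulaDiagonal

/-! ### The main theorem -/

open CopulaDiagonal

theorem mainTheorem8 {Ω : Type*} [MeasurableSpace Ω] (μ : Measure Ω) [IsProbabilityMeasure μ]
    (X : ℕ → Ω → ℝ) (hX : ∀ i, Measurable (X i)) (hstat : StrictlyStationary μ X)
    (hF : Continuous (margin μ X)) (H : ℝ → ℝ) (c d : ℕ → ℝ)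
    (hMDA : InMDA (margin μ X) H c d) :
    ((∀ x, 0 < H x → CondD μ X (fun n => c n * x + d n)) →
      (∃ u ∈ Ioo (0 : ℝ) 1, ∃ γ ∈ Ioo (0 : ℝ) 1,
        Tendsto (fun n => diagPowerDistortion μ X (fun n => (n : ℝ)) n u) atTop (𝓝 γ)) →
      ∃ θ ∈ Ioc (0 : ℝ) 1,
        HasAsymptoticPowerDiagonal μ X θ ∧
        HasAsymptoticPowerDiagonalWithRate μ X (fun n => (n : ℝ)) θ ∧
        TendstoInLaw μ (fun n ω => (runMax X n ω - d n) / c n) (fun x => H x ^ θ)) ∧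
    ((∀ x, 0 < H x →
        CondD μ X (fun n => c n * x + d n) ∧ CondD' μ X (fun n => c n * x + d n)) →
      HasAsymptoticPowerDiagonal μ X 1 ∧
      HasAsymptoticPowerDiagonalWithRate μ X (fun n => (n : ℝ)) 1) := by
  constructor
  · rintro hD ⟨u, hu, γ, hγ, hlim⟩
    have h := hasAsymptoticPowerDiagonalWithRate_of_tendsto hX hstat hF
      (hMDA.tendsto_diagPowerDistortion_sub_pow hX hstat hF hD) hu hγ hlim
    exact ⟨_, ⟨h.1, h.index_le_one hX hstat hF⟩, ⟨_, h⟩, h, h.tendstoInLaw hX hstat hF hMDA⟩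
  · intro hDD
    have hmix := hMDA.tendsto_diagPowerDistortion_sub_pow hX hstat hF fun x hx => (hDD x hx).1
    obtain ⟨x, hx0, hx1, hxc⟩ := hMDA.exists_pos_lt margin_mono hF (tendsto_cdf_atBot _)
      (tendsto_cdf_atTop _) one_pos
    have hrate := tendsto_mul_one_sub_of_pow (fun n => margin_mem_Icc (c n * x + d n)) hx0
      (hMDA.2.2.2 x hxc)
    have h1 := (hDD x hx0).1.tendsto_levelProb_of_condD' hX hstat (hDD x hx0).2 hrate
    have h2 := tendsto_copulaDiag_sub hX hstat hF (m := fun n => n)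
      (fun n => margin_mem_Icc (c n * x + d n))
      (fun n => rpow_one_div_mem_Icc ⟨hx0.le, hx1.le⟩ n) hrate
      (tendsto_mul_one_sub_rpow ⟨hx0, hx1.le⟩)
    simp only [copulaDiag_margin hX hstat hF] at h2
    have h3 := h1.sub h2
    simp only [sub_sub_cancel, sub_zero, neg_neg, Real.exp_log hx0] at h3
    -- Here `u = γ = H x`, since the limit `exp(-τ)` with `τ = -log (H x)` is `H x` itself.
    have h := hasAsymptoticPowerDiagonalWithRate_of_tendsto hX hstat hF hmix ⟨hx0, hx1⟩
      ⟨hx0, hx1⟩ h3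
    rw [div_self (Real.log_neg hx0 hx1).ne] at h
    exact ⟨⟨_, h⟩, h⟩
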